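/- **Definitions.** A *strong projection algebra* is a set $P$ with two binary operations $\times,\star$ such that for all $e,f,g\in P$: - $e\times e=e$, $(e\times f)\times e=e\times f$, $e\times(f\times g)=(e\times f)\times(f\times g)$, $(e\times f)\times g=(e\times f)\times(e\times g)$; - $e\star e=e$, $f\star e=e\star(f\star e)$, $(g\star f)\star e=(g\star f)\star(f\star e)$, $g\star(f\star e)=(g\star e)\star(f\star e)$; - $(e\star(f\times g))\star g=(e\star f)\star g$, $g\times((g\star f)\times e)=g\times(f\times e)$, $(e\times f)\star e=e\times f$, $f\times(e\star f)=e\star f$; - $e\times(((e\times f)\times g)\star f)=(e\times f)\times g$, $(f\times(g\star(f\star e)))\star e=g\star(f\star e)$. A *DRC-restriction semigroup* is a semigroup $S$ with two unary operations ${}^+,{}^*$ such that for all $x,y\in S$: - $x^+x=x$, $(xy)^+=(xy^+)^+$, $(xy)^+=x^+(xy)^+x^+$, $x^{++}=x^+$, $x^{+*}=x^+$; - $xx^*=x$, $(xy)^*=(x^*y)^*$, $(xy)^*=y^*(xy)^*y^*$, $x^{**}=x^*$, $x^{*+}=x^*$; - $x(yx)^*=(yx^+)^*x$, $(xy)^+x=x(x^*y)^+$.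 Its *projection algebra* is $P(S)=\{x^+\mid x\in S\}$ with $e\times f=(ef)^+$ and $e\star f=(ef)^*$; isomorphisms of projection algebras are the bijections preserving $\times$ and $\star$. Let $\mathbf E(S)$ be the subsemigroup of $S$ generated by $P(S)$, with the operations ${}^+,{}^*$ inherited from $S$; $S$ is *projection-generated* if $\mathbf E(S)=S$. A *$(2,1,1)$-congruence* is an equivalence relation compatible with the product, ${}^+$ and ${}^*$; it is *projection-separating* if it relates no two distinct projections. $S$ is *projection-fundamental* if equality is its only projection-separating $(2,1,1)$-congruence. Let $\mu_S$ be the $(2,1,1)$-congruence with $a\mathrel{\mu_S}b$ if and only if $a^+=b^+$, $a^*=b^*$, and $(ap)^+=(bp)^+$, $(pa)^*=(pb)^*$ for all $p\in P(S)$ (it is the greatest projection-separating $(2,1,1)$-congruence). Below, $\cong$ between DRC-restriction semigroups means isomorphism with respect to the product, ${}^+$ and ${}^*$. Let $P$ be a strong projection algebra. Write $e\le f$ if $e=f\times e$, and $p\mathrel{\mathcal F}q$ if $p\times q=p$ and $p\star q=q$. A *path* is a sequence $\mathfrak p=(p_1,\dots,p_k)$ with $k\ge 1$ and $p_1\mathrel{\mathcal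 F}p_2\mathrel{\mathcal F}\cdots\mathrel{\mathcal F}p_k$; put $\mathbf d(\mathfrak p)=p_1$, $\mathbf r(\mathfrak p)=p_k$. Paths with $p_k=q_1$ compose as $(p_1,\dots,p_k)\circ(q_1,\dots,q_l)=(p_1,\dots,p_k,q_2,\dots,q_l)$. For $q\le p_1$ let ${}_q{\downharpoonleft}\mathfrak p=(q_1,\dots,q_k)$ with $q_1=q$ and $q_i=q_{i-1}\star p_i$ for $i>1$; for $q\le p_k$ let $\mathfrak p{\downharpoonright}_q=(q_1,\dots,q_k)$ with $q_k=q$ and $q_i=p_i\times q_{i+1}$ for $i<k$. Let $\approx$ be the least congruence on the category of paths containing all pairs $((p,p),(p))$ with $p\in P$ and all pairs $((e,e\star p,f),(e,p\times f,f))$ with $f=(e\star p)\star f$ and $e=e\times(p\times f)$. The *chain semigroup* $\mathbf S(\mathscr C(P))$ is the set of $\approx$-classes of paths with $$[\mathfrak p][\mathfrak q]=\big[\mathfrak p{\downharpoonright}_{r\times s}\circ(r\times s,\,r\star s)\circ{}_{r\star s}{\downharpoonleft}\mathfrak q\big]\quad(r=\mathbf r(\mathfrak p),\ s=\mathbf d(\mathfrak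 q)),\qquad [\mathfrak p]^+=[\mathbf d(\mathfrak p)],\quad [\mathfrak p]^*=[\mathbf r(\mathfrak p)];$$ it is a DRC-restriction semigroup. **Theorem 8.10.** Let $P$ be a strong projection algebra and $\mu=\mu_{\mathbf S(\mathscr C(P))}$. 1. If $S$ is a projection-fundamental DRC-restriction semigroup whose projection algebra is isomorphic to $P$, then $\mathbf E(S)\cong\mathbf S(\mathscr C(P))/\mu$. In particular, if $S$ is moreover projection-generated, then $S\cong\mathbf S(\mathscr C(P))/\mu$. 2. $\mathbf S(\mathscr C(P))/\mu$ is itself a projection-generated projection-fundamental DRC-restriction semigroup whose projection algebra is isomorphic to $P$. Hence, up to isomorphism, it is the unique such semigroup. -/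

import Mathlib

/-- The two binary operations of a (two-sided) projection algebra. -/
class ProjectionOps (P : Type*) where
  lmul : P → P → P
  rmul : P → P → P

infixl:70 " ×ₚ " => ProjectionOps.lmul
infixl:70 " ⋆ₚ " => ProjectionOps.rmul

/-- Two-sided projection algebras. -/
class ProjectionAlgebra (P : Type*) extends ProjectionOps P where
  L1 (e : P) : e ×ₚ e = e
  L2 (e f : P) : (e ×ₚ f) ×ₚ e = e ×ₚ f
  L3 (e f g : P) : e ×ₚ (f ×ₚ g) = (e ×ₚ f) ×ₚ (f ×ₚ g)
  L4 (e f g : P) : (e ×ₚ f) ×ₚ g = (e ×ₚ f) ×ₚ (e ×ₚ g)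
  R1 (e : P) : e ⋆ₚ e = e
  R2 (e f : P) : f ⋆ₚ e = e ⋆ₚ (f ⋆ₚ e)
  R3 (e f g : P) : (g ⋆ₚ f) ⋆ₚ e = (g ⋆ₚ f) ⋆ₚ (f ⋆ₚ e)
  R4 (e f g : P) : g ⋆ₚ (f ⋆ₚ e) = (g ⋆ₚ e) ⋆ₚ (f ⋆ₚ e)
  P3_right (e f g : P) : (e ⋆ₚ (f ×ₚ g)) ⋆ₚ g = (e ⋆ₚ f) ⋆ₚ g
  P3_left (e f g : P) : g ×ₚ ((g ⋆ₚ f) ×ₚ e) = g ×ₚ (f ×ₚ e)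
  P4_right (e f : P) : (e ×ₚ f) ⋆ₚ e = e ×ₚ f
  P4_left (e f : P) : f ×ₚ (e ⋆ₚ f) = e ⋆ₚ f

/-- Strong (two-sided) projection algebras. -/
class StrongProjectionAlgebra (P : Type*) extends ProjectionAlgebra P where
  SP1 (e f g : P) : e ×ₚ (((e ×ₚ f) ×ₚ g) ⋆ₚ f) = (e ×ₚ f) ×ₚ g
  SP2 (e f g : P) : (f ×ₚ (g ⋆ₚ (f ⋆ₚ e))) ⋆ₚ e = g ⋆ₚ (f ⋆ₚ e)

namespace ProjectionAlgebra

/-- The natural order `e ≤ f ↔ e = f × e` of a projection algebra. -/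
def Le {P : Type*} [ProjectionOps P] (e f : P) : Prop := e = f ×ₚ e

/-- The relation `p 𝓕 q ↔ p = p × q ∧ q = p ⋆ q`. -/
def F {P : Type*} [ProjectionOps P] (p q : P) : Prop := p ×ₚ q = p ∧ p ⋆ₚ q = q

section
variable {P : Type*} [ProjectionAlgebra P] {e f g p q : P}

theorem le_refl (e : P) : Le e e := (L1 e).symm

theorem lmul_le (e f : P) : Le (e ×ₚ f) e := by
  have := L4 e e f; rwa [L1] at this

theorem Le.lmul (h : Le e f) : f ×ₚ e = e := h.symm

theorem Le.lmul' (h : Le e f) : e ×ₚ f = e := by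
  have := L2 f e; rwa [← h] at this

theorem Le.rmul (h : Le e f) : e ⋆ₚ f = e := by
  have := P4_right f e; rwa [← h] at this

theorem Le.rmul' (h : Le e f) : f ⋆ₚ e = e := by
  have := R2 f e; rw [h.rmul] at this; exact this.symm

theorem le_of_rmul (h : e ⋆ₚ f = e) : Le e f := by
  have := P4_left e f; rw [h] at this; exact this.symm

theorem rmul_le (e f : P) : Le (e ⋆ₚ f) f := (P4_left e f).symm

theorem Le.trans (h : Le e f) (h' : Le f g) : Le e g := by
  have h1 := L3 g f e
  rw [← h, h'.lmul, ← h] at h1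
  exact h1.symm

theorem lmul_rmul (e f : P) : (e ×ₚ f) ⋆ₚ f = e ⋆ₚ f := by
  have h := P3_right e e f
  rwa [(lmul_le e f).rmul', R1] at h

theorem lmul_rmul' (e f : P) : e ×ₚ (e ⋆ₚ f) = e ×ₚ f := by
  have h := P3_left f f e
  rwa [(rmul_le e f).lmul', L1] at h

theorem lmul_lmul_rmul (e f : P) : (e ×ₚ f) ×ₚ (e ⋆ₚ f) = e ×ₚ f := by
  rw [L4, lmul_rmul', L1]

theorem lmul_rmul_rmul (e f : P) : (e ×ₚ f) ⋆ₚ (e ⋆ₚ f) = e ⋆ₚ f := by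
  rw [R4, lmul_rmul, R1]

theorem Le.lmul_mono (h : Le e f) (g : P) : Le (g ×ₚ e) (g ×ₚ f) := by
  have h1 := L3 g f e
  rwa [h.lmul, L4] at h1

theorem Le.rmul_mono (h : Le e f) (g : P) : Le (e ⋆ₚ g) (f ⋆ₚ g) := by
  have h1 := R3 g f e
  rw [h.rmul, R4, ← R4 g f e] at h1
  exact le_of_rmul (by rw [← R4]; exact h1.symm)

theorem f_lmul_rmul (e f : P) : F (e ×ₚ f) (e ⋆ₚ f) :=
  ⟨lmul_lmul_rmul e f, lmul_rmul_rmul e f⟩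

theorem f_refl (e : P) : F e e := ⟨L1 e, R1 e⟩

theorem Le.rmul_rmul (h : Le e f) (g : P) : e ⋆ₚ (f ⋆ₚ g) = e ⋆ₚ g := by
  have h1 := R3 g f e
  rw [h.rmul] at h1
  exact h1.symm

theorem Le.lmul_lmul (h : Le e f) (g : P) : (g ×ₚ f) ×ₚ e = g ×ₚ e := by
  have h1 := L3 g f e
  rw [h.lmul] at h1
  exact h1.symm
end

section
variable {P : Type*} [StrongProjectionAlgebra P] {e f g p q x : P}

theorem Le.sp1 (h : Le g (e ×ₚ f)) : e ×ₚ (g ⋆ₚ f) = g := by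
  have h1 := StrongProjectionAlgebra.SP1 e f g
  rwa [h.lmul] at h1

theorem Le.sp2 (h : Le g (f ⋆ₚ e)) : (f ×ₚ g) ⋆ₚ e = g := by
  have h1 := StrongProjectionAlgebra.SP2 e f g
  rwa [h.rmul] at h1

theorem F.left_step (h : F p x) (hq : Le q p) : p ×ₚ (q ⋆ₚ x) = q ∧ F q (q ⋆ₚ x) := by
  have h1 : p ×ₚ (q ⋆ₚ x) = q := Le.sp1 (by rwa [h.1])
  refine ⟨h1, ?_, ?_⟩
  · rw [lmul_rmul']
    have h2 := L4 p (q ⋆ₚ x) x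
    rwa [h.1, L2, h1] at h2
  · rw [R4, R1]

theorem F.right_step (h : F p x) (hq : Le q x) : (p ×ₚ q) ⋆ₚ x = q ∧ F (p ×ₚ q) q := by
  have h1 : (p ×ₚ q) ⋆ₚ x = q := Le.sp2 (by rwa [h.2])
  refine ⟨h1, ?_, ?_⟩
  · rw [L4, L1]
  · rw [lmul_rmul]
    have h2 := R4 x (p ×ₚ q) p
    rwa [h.2, ← R2, h1] at h2

theorem rmul_lmul_eq (p s t : P) : (p ⋆ₚ s) ×ₚ t = (p ×ₚ (s ×ₚ t)) ⋆ₚ s := by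
  rw [← P3_left t s p]
  exact (Le.sp2 (lmul_le (p ⋆ₚ s) t)).symm

theorem rmul_lmul_eq' (p s t : P) : t ⋆ₚ (s ×ₚ p) = s ×ₚ ((t ⋆ₚ s) ⋆ₚ p) := by
  rw [← P3_right t s p]
  exact (Le.sp1 (rmul_le t (s ×ₚ p))).symm
end

/-- Admissible triples `(e, p, f)` of a projection algebra. -/
def Admissible {P : Type*} [ProjectionOps P] (e p f : P) : Prop :=
  f = (e ⋆ₚ p) ⋆ₚ f ∧ e = e ×ₚ (p ×ₚ f)

section
variable {P : Type*} [StrongProjectionAlgebra P] {e f p q : P}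

theorem Admissible.left (h : Admissible e p f) : F e (e ⋆ₚ p) ∧ F (e ⋆ₚ p) f := by
  obtain ⟨h1, h2⟩ := h
  have h3 : e ×ₚ p = e := by
    have h4 := (lmul_le p f).lmul_mono e
    rw [← h2] at h4
    have h5 := L4 e e p
    rwa [L1, h4.lmul'] at h5
  refine ⟨⟨by rw [lmul_rmul', h3], by rw [R4, R1]⟩, ?_, h1.symm⟩
  rw [rmul_lmul_eq, ← h2]

theorem Admissible.right (h : Admissible e p f) : F e (p ×ₚ f) ∧ F (p ×ₚ f) f := by
  obtain ⟨h1, h2⟩ := h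
  have h3 : p ⋆ₚ f = f := by
    have h4 := (rmul_le e p).rmul_mono f
    rw [← h1] at h4
    have h5 := h4.rmul
    rw [← R2] at h5
    exact h5
  refine ⟨⟨h2.symm, ?_⟩, ⟨by rw [L4, L1], by rw [lmul_rmul, h3]⟩⟩
  rw [rmul_lmul_eq', ← h1]

theorem Admissible.leftRes (h : Admissible e p f) (hq : Le q e) :
    Admissible q p ((q ⋆ₚ p) ⋆ₚ f) := by
  refine ⟨by rw [R4, R1], ?_⟩
  rw [← rmul_lmul_eq', lmul_rmul']
  have h1 := L4 e q (p ×ₚ f)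
  rw [hq.lmul, ← h.2, hq.lmul'] at h1
  exact h1.symm

theorem Admissible.rightRes (h : Admissible e p f) (hq : Le q f) :
    Admissible (e ×ₚ (p ×ₚ q)) p q := by
  refine ⟨?_, by rw [L4, L1]⟩
  rw [← rmul_lmul_eq, lmul_rmul]
  have h1 := R4 f q (e ⋆ₚ p)
  rw [hq.rmul, ← h.1, hq.rmul'] at h1
  exact h1.symm
end

end ProjectionAlgebra

open ProjectionAlgebra

/-- A `P`-path `(p₁, p₂, …, pₖ)` with `k ≥ 1` and `p₁ 𝓕 p₂ 𝓕 ⋯ 𝓕 pₖ`: here `head = p₁` and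
`tail = [p₂, …, pₖ]`. -/
@[ext]
structure PPath (P : Type*) [ProjectionOps P] where
  head : P
  tail : List P
  chain : List.IsChain F (head :: tail)

namespace PPath

/-- The last entry of the list `p₁ = p`, `[p₂, …, pₖ] = l`. -/
def last {P : Type*} : P → List P → P
  | p, [] => p
  | _, x :: l => last x l

section
variable {P : Type*} [ProjectionOps P]

/-- The domain `p₁` of `(p₁, …, pₖ)`. -/
def dom (a : PPath P) : P := a.head

/-- The codomain `pₖ` of `(p₁, …, pₖ)`. -/
def cod (a : PPath P) : P := last a.head a.tail

/-- The path `(p)` of length one. -/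
def single (p : P) : PPath P := ⟨p, [], by simp⟩

/-- The path `(p, q)`, where `p 𝓕 q`. -/
def pair (p q : P) (h : F p q) : PPath P := ⟨p, [q], by simpa using h⟩

/-- The path `(p, q, r)`, where `p 𝓕 q 𝓕 r`. -/
def triple (p q r : P) (h : F p q) (h' : F q r) : PPath P := ⟨p, [q, r], by simpa using ⟨h, h'⟩⟩

theorem chain_append : ∀ (l m : List P) (p : P), List.IsChain F (p :: l) →
    List.IsChain F (last p l :: m) → List.IsChain F (p :: (l ++ m))
  | [], _, _, _, h => h
  | x :: l, m, p, h, h' => by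
    rw [List.isChain_cons_cons] at h
    rw [List.cons_append, List.isChain_cons_cons]
    exact ⟨h.1, chain_append l m x h.2 h'⟩

/-- The composition `(p₁, …, pₖ = q₁, …, qₗ)` of `(p₁, …, pₖ)` and `(q₁, …, qₗ)`, where
`pₖ = q₁`. -/
def comp (a b : PPath P) (h : a.cod = b.dom) : PPath P :=
  ⟨a.head, a.tail ++ b.tail, chain_append _ _ _ a.chain (by
    have := b.chain
    rw [← dom, ← h] at this
    exact this)⟩

/-- For `l = [p₂, …, pₖ]`, the list `[q₂, …, qₖ]` with `qᵢ = qᵢ₋₁ ⋆ pᵢ` and `q₁ = q`. -/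
def leftTail : P → List P → List P
  | _, [] => []
  | q, x :: l => (q ⋆ₚ x) :: leftTail (q ⋆ₚ x) l

/-- For the list `p₁ = p`, `[p₂, …, pₖ] = l`, the pair of `q₁` and `[q₂, …, qₖ]`, where
`qₖ = q` and `qᵢ = pᵢ × qᵢ₊₁` for `i < k`. -/
def rightPair : P → List P → P → P × List P
  | _, [], q => (q, [])
  | p, x :: l, q => (p ×ₚ (rightPair x l q).1, (rightPair x l q).1 :: (rightPair x l q).2)

end

theorem last_append {P : Type*} : ∀ (l m : List P) (p : P),
    last p (l ++ m) = last (last p l) m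
  | [], _, _ => rfl
  | x :: l, m, _ => last_append l m x

section
variable {P : Type*} [ProjectionOps P]

theorem dom_comp (a b : PPath P) (h : a.cod = b.dom) : (a.comp b h).dom = a.dom := rfl

theorem cod_comp (a b : PPath P) (h : a.cod = b.dom) : (a.comp b h).cod = b.cod := by
  change last a.head (a.tail ++ b.tail) = last b.head b.tail
  rw [last_append]
  change last a.cod b.tail = _
  rw [h]; rfl

theorem comp_assoc (a b c : PPath P) (h : a.cod = b.dom) (h' : b.cod = c.dom) :
    (a.comp b h).comp c ((cod_comp a b h).trans h') =
      a.comp (b.comp c h') h := by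
  apply PPath.ext
  · rfl
  · exact List.append_assoc _ _ _

theorem leftTail_append : ∀ (l m : List P) (q : P),
    leftTail q (l ++ m) = leftTail q l ++ leftTail (last q (leftTail q l)) m
  | [], _, _ => rfl
  | x :: l, m, q => by simp [leftTail, last, leftTail_append l m]

theorem rightPair_append : ∀ (l m : List P) (p q : P),
    rightPair p (l ++ m) q =
      ((rightPair p l (rightPair (last p l) m q).1).1,
        (rightPair p l (rightPair (last p l) m q).1).2 ++ (rightPair (last p l) m q).2)
  | [], _, _, _ => rfl
  | x :: l, m, p, q => by simp [rightPair, last, rightPair_append l m x q]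

theorem rightPair_last : ∀ (l : List P) (p q : P),
    last (rightPair p l q).1 (rightPair p l q).2 = q
  | [], _, _ => rfl
  | x :: l, _, q => rightPair_last l x q
end

section
variable {P : Type*} [StrongProjectionAlgebra P]

theorem leftTail_le : ∀ (l : List P) (p q : P), Le q p →
    Le (last q (leftTail q l)) (last p l)
  | [], _, _, h => h
  | x :: l, _, q, _ => leftTail_le l x (q ⋆ₚ x) (rmul_le q x)

theorem leftTail_chain : ∀ (l : List P) (p q : P), List.IsChain F (p :: l) → Le q p →
    List.IsChain F (q :: leftTail q l)
  | [], _, _, _, _ => by simp [leftTail]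
  | x :: l, p, q, h, hq => by
    rw [List.isChain_cons_cons] at h
    rw [leftTail, List.isChain_cons_cons]
    exact ⟨(h.1.left_step hq).2, leftTail_chain l x _ h.2 (rmul_le q x)⟩

theorem rightPair_le : ∀ (l : List P) (p q : P), Le q (last p l) →
    Le (rightPair p l q).1 p
  | [], _, _, h => h
  | _ :: _, _, _, _ => lmul_le _ _

theorem rightPair_chain : ∀ (l : List P) (p q : P), List.IsChain F (p :: l) →
    Le q (last p l) → List.IsChain F ((rightPair p l q).1 :: (rightPair p l q).2)
  | [], _, _, _, _ => by simp [rightPair]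
  | x :: l, p, q, h, hq => by
    rw [List.isChain_cons_cons] at h
    have hq' : Le q (last x l) := hq
    rw [rightPair, List.isChain_cons_cons]
    exact ⟨(h.1.right_step (rightPair_le l x q hq')).2, rightPair_chain l x q h.2 hq'⟩

/-- The left restriction `(q₁, …, qₖ)` of `(p₁, …, pₖ)` to `q ≤ p₁`: here `q₁ = q` and
`qᵢ = qᵢ₋₁ ⋆ pᵢ`. -/
def leftRes (a : PPath P) (q : P) (h : Le q a.dom) : PPath P :=
  ⟨q, leftTail q a.tail, leftTail_chain _ _ _ a.chain h⟩

/-- The right restriction `(q₁, …, qₖ)` of `(p₁, …, pₖ)` to `q ≤ pₖ`: here `qₖ = q` and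
`qᵢ = pᵢ × qᵢ₊₁`. -/
def rightRes (a : PPath P) (q : P) (h : Le q a.cod) : PPath P :=
  ⟨(rightPair a.head a.tail q).1, (rightPair a.head a.tail q).2, rightPair_chain _ _ _ a.chain h⟩

theorem leftTail_self : ∀ (l : List P) (p : P), List.IsChain F (p :: l) → leftTail p l = l
  | [], _, _ => rfl
  | x :: l, p, h => by
    rw [List.isChain_cons_cons] at h
    rw [leftTail, h.1.2, leftTail_self l x h.2]

theorem rightPair_self : ∀ (l : List P) (p : P), List.IsChain F (p :: l) →
    rightPair p l (last p l) = (p, l)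
  | [], _, _ => rfl
  | x :: l, p, h => by
    rw [List.isChain_cons_cons] at h
    have := rightPair_self l x h.2
    simp only [rightPair, last, this, h.1.1]

theorem leftTail_leftTail : ∀ (l : List P) (q r : P), Le r q →
    leftTail r (leftTail q l) = leftTail r l
  | [], _, _, _ => rfl
  | x :: l, q, r, h => by
    rw [leftTail, leftTail, leftTail, h.rmul_rmul, leftTail_leftTail l _ _ (h.rmul_mono x)]

theorem rightPair_mono : ∀ (l : List P) (p q r : P), Le r q →
    Le (rightPair p l r).1 (rightPair p l q).1
  | [], _, _, _, h => h
  | x :: l, p, q, r, h => (rightPair_mono l x q r h).lmul_mono p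

theorem rightPair_rightPair : ∀ (l : List P) (p q r : P), Le r q →
    rightPair (rightPair p l q).1 (rightPair p l q).2 r = rightPair p l r
  | [], _, _, _, _ => rfl
  | x :: l, p, q, r, h => by
    simp only [rightPair]
    rw [rightPair_rightPair l x q r h, (rightPair_mono l x q r h).lmul_lmul p]

theorem rightPair_leftTail : ∀ (l : List P) (p q : P), List.IsChain F (p :: l) → Le q p →
    rightPair p l (last q (leftTail q l)) = (q, leftTail q l)
  | [], _, _, _, _ => rfl
  | x :: l, p, q, h, hq => by
    rw [List.isChain_cons_cons] at h
    have := rightPair_leftTail l x (q ⋆ₚ x) h.2 (rmul_le q x)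
    simp only [leftTail, last, rightPair, this, (h.1.left_step hq).1]

theorem leftTail_rightPair : ∀ (l : List P) (p q : P), List.IsChain F (p :: l) →
    Le q (last p l) → leftTail (rightPair p l q).1 l = (rightPair p l q).2
  | [], _, _, _, _ => rfl
  | x :: l, p, q, h, hq => by
    rw [List.isChain_cons_cons] at h
    have hq' : Le q (last x l) := hq
    have := leftTail_rightPair l x q h.2 hq'
    rw [rightPair, leftTail, (h.1.right_step (rightPair_le l x q hq')).1, this]

theorem dom_leftRes (a : PPath P) (q : P) (h : Le q a.dom) : (a.leftRes q h).dom = q := rfl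

theorem cod_leftRes_le (a : PPath P) (q : P) (h : Le q a.dom) :
    Le (a.leftRes q h).cod a.cod := leftTail_le _ _ _ h

theorem cod_rightRes (a : PPath P) (q : P) (h : Le q a.cod) : (a.rightRes q h).cod = q :=
  rightPair_last _ _ _

theorem dom_rightRes_le (a : PPath P) (q : P) (h : Le q a.cod) :
    Le (a.rightRes q h).dom a.dom := rightPair_le _ _ _ h

theorem leftRes_dom (a : PPath P) : a.leftRes a.dom (le_refl _) = a :=
  PPath.ext rfl (leftTail_self _ _ a.chain)

theorem rightRes_cod (a : PPath P) : a.rightRes a.cod (le_refl _) = a := by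
  have := rightPair_self _ _ a.chain
  exact PPath.ext (congrArg Prod.fst this) (congrArg Prod.snd this)

theorem rightRes_leftRes (a : PPath P) (q : P) (h : Le q a.dom) :
    a.rightRes (a.leftRes q h).cod (cod_leftRes_le a q h) = a.leftRes q h := by
  have := rightPair_leftTail _ _ _ a.chain h
  exact PPath.ext (congrArg Prod.fst this) (congrArg Prod.snd this)

theorem leftRes_rightRes (a : PPath P) (q : P) (h : Le q a.cod) :
    a.leftRes (a.rightRes q h).dom (dom_rightRes_le a q h) = a.rightRes q h :=
  PPath.ext rfl (leftTail_rightPair _ _ _ a.chain h)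

theorem leftRes_comp (a b : PPath P) (h : a.cod = b.dom) (q : P)
    (hq : Le q (a.comp b h).dom) :
    (a.comp b h).leftRes q hq =
      (a.leftRes q hq).comp (b.leftRes (a.leftRes q hq).cod (h ▸ cod_leftRes_le a q hq)) rfl :=
  PPath.ext rfl (leftTail_append _ _ _)

theorem rightRes_comp (a b : PPath P) (h : a.cod = b.dom) (q : P)
    (hq : Le q (a.comp b h).cod) :
    (a.comp b h).rightRes q hq =
      (a.rightRes (b.rightRes q (cod_comp a b h ▸ hq)).dom (h ▸ dom_rightRes_le b q _)).comp
        (b.rightRes q (cod_comp a b h ▸ hq)) (cod_rightRes _ _ _) := by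
  have h1 := rightPair_append a.tail b.tail a.head q
  have h2 : last a.head a.tail = b.head := h
  rw [h2] at h1
  apply PPath.ext
  · change (rightPair a.head (a.tail ++ b.tail) q).1 = _
    rw [h1]; rfl
  · change (rightPair a.head (a.tail ++ b.tail) q).2 = _
    rw [h1]; rfl

/-- The path-level product
`a↓_{p'} ∘ (p', q') ∘ _{q'}↓b`, where `p' = r(a) × d(b)` and `q' = r(a) ⋆ d(b)`. -/
def mul (a b : PPath P) : PPath P :=
  ((a.rightRes (a.cod ×ₚ b.dom) (lmul_le _ _)).comp
    (pair (a.cod ×ₚ b.dom) (a.cod ⋆ₚ b.dom) (f_lmul_rmul _ _)) (cod_rightRes _ _ _)).comp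
    (b.leftRes (a.cod ⋆ₚ b.dom) (rmul_le _ _)) (cod_comp _ _ _)

/-- The least congruence `≈` on the path category that contains all pairs `((p, p), (p))` and all
pairs `((e, e ⋆ p, f), (e, p × f, f))` with `(e, p, f)` admissible. -/
inductive Rel : PPath P → PPath P → Prop
  | refl (a : PPath P) : Rel a a
  | symm {a b : PPath P} : Rel a b → Rel b a
  | trans {a b c : PPath P} : Rel a b → Rel b c → Rel a c
  | dup (p : P) : Rel (pair p p (f_refl p)) (single p)
  | adm (e p f : P) (h : Admissible e p f) :
      Rel (triple e (e ⋆ₚ p) f h.left.1 h.left.2) (triple e (p ×ₚ f) f h.right.1 h.right.2)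
  | comp_left (u : PPath P) {a b : PPath P} (ha : u.cod = a.dom) (hb : u.cod = b.dom) :
      Rel a b → Rel (u.comp a ha) (u.comp b hb)
  | comp_right (v : PPath P) {a b : PPath P} (ha : a.cod = v.dom) (hb : b.cod = v.dom) :
      Rel a b → Rel (a.comp v ha) (b.comp v hb)

namespace Rel

theorem dom_eq {a b : PPath P} (h : Rel a b) : a.dom = b.dom := by
  induction h with
  | refl a => rfl
  | symm _ ih => exact ih.symm
  | trans _ _ ih ih' => exact ih.trans ih'
  | dup p => rfl
  | adm e p f h => rfl
  | comp_left u ha hb _ ih => rfl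
  | comp_right v ha hb _ ih => exact ih

theorem cod_eq {a b : PPath P} (h : Rel a b) : a.cod = b.cod := by
  induction h with
  | refl a => rfl
  | symm _ ih => exact ih.symm
  | trans _ _ ih ih' => exact ih.trans ih'
  | dup p => rfl
  | adm e p f h => rfl
  | comp_left u ha hb _ ih => rw [cod_comp, cod_comp, ih]
  | comp_right v ha hb _ ih => rw [cod_comp, cod_comp]

theorem comp {a a' b b' : PPath P} (h : Rel a a') (h' : Rel b b') (hab : a.cod = b.dom) :
    Rel (a.comp b hab) (a'.comp b' (by rw [← h.cod_eq, hab, h'.dom_eq])) :=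
  (comp_right b hab (by rw [← h.cod_eq, hab]) h).trans (comp_left a' _ _ h')

theorem leftRes_congr {a b : PPath P} (h : a = b) {q r : P} (hqr : q = r) (hq : Le q a.dom)
    (hr : Le r b.dom) : Rel (a.leftRes q hq) (b.leftRes r hr) := by
  subst h; subst hqr; exact refl _

theorem leftRes {a b : PPath P} (h : Rel a b) : ∀ (q : P) (ha : Le q a.dom) (hb : Le q b.dom),
    Rel (a.leftRes q ha) (b.leftRes q hb) := by
  induction h with
  | refl a => intro q ha hb; exact refl _
  | symm h ih => intro q ha hb; exact (ih q hb ha).symm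
  | trans h h' ih ih' =>
    intro q ha hb
    exact (ih q ha (h.dom_eq ▸ ha)).trans (ih' q (h.dom_eq ▸ ha) hb)
  | dup p =>
    intro q ha hb
    have hq : q ⋆ₚ p = q := Le.rmul ha
    have : (pair p p (f_refl p)).leftRes q ha = pair q q (f_refl q) := by
      apply PPath.ext
      · rfl
      · change [q ⋆ₚ p] = [q]; rw [hq]
    rw [this]
    exact dup q
  | adm e p f h =>
    intro q ha hb
    change Le q e at ha
    have hl : (triple e (e ⋆ₚ p) f h.left.1 h.left.2).leftRes q ha =
        triple q (q ⋆ₚ p) ((q ⋆ₚ p) ⋆ₚ f) (h.leftRes ha).left.1 (h.leftRes ha).left.2 := by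
      apply PPath.ext
      · rfl
      · change [q ⋆ₚ (e ⋆ₚ p), (q ⋆ₚ (e ⋆ₚ p)) ⋆ₚ f] = [q ⋆ₚ p, (q ⋆ₚ p) ⋆ₚ f]
        rw [Le.rmul_rmul ha]
    have hr : (triple e (p ×ₚ f) f h.right.1 h.right.2).leftRes q hb =
        triple q (p ×ₚ ((q ⋆ₚ p) ⋆ₚ f)) ((q ⋆ₚ p) ⋆ₚ f) (h.leftRes ha).right.1
          (h.leftRes ha).right.2 := by
      apply PPath.ext
      · rfl
      · change [q ⋆ₚ (p ×ₚ f), (q ⋆ₚ (p ×ₚ f)) ⋆ₚ f] = [p ×ₚ ((q ⋆ₚ p) ⋆ₚ f), (q ⋆ₚ p) ⋆ₚ f]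
        rw [P3_right, rmul_lmul_eq']
    rw [hl, hr]
    exact adm q p _ (h.leftRes ha)
  | comp_left u ha hb h ih =>
    intro q hqa hqb
    rw [leftRes_comp, leftRes_comp]
    exact comp_left _ _ _ (ih _ _ _)
  | @comp_right v a b ha hb h ih =>
    intro q hqa hqb
    rw [leftRes_comp, leftRes_comp]
    have h1 := ih q hqa hqb
    exact h1.comp (leftRes_congr rfl h1.cod_eq _ _) _

theorem rightRes_congr {a b : PPath P} (h : a = b) {q r : P} (hqr : q = r) (hq : Le q a.cod)
    (hr : Le r b.cod) : Rel (a.rightRes q hq) (b.rightRes r hr) := by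
  subst h; subst hqr; exact refl _

theorem rightRes {a b : PPath P} (h : Rel a b) : ∀ (q : P) (ha : Le q a.cod) (hb : Le q b.cod),
    Rel (a.rightRes q ha) (b.rightRes q hb) := by
  induction h with
  | refl a => intro q ha hb; exact refl _
  | symm h ih => intro q ha hb; exact (ih q hb ha).symm
  | trans h h' ih ih' =>
    intro q ha hb
    exact (ih q ha (h.cod_eq ▸ ha)).trans (ih' q (h.cod_eq ▸ ha) hb)
  | dup p =>
    intro q ha hb
    have hq : p ×ₚ q = q := Le.lmul ha
    have : (pair p p (f_refl p)).rightRes q ha = pair q q (f_refl q) := by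
      apply PPath.ext
      · exact hq
      · rfl
    rw [this]
    exact dup q
  | adm e p f h =>
    intro q ha hb
    change Le q f at ha
    have hl : (triple e (e ⋆ₚ p) f h.left.1 h.left.2).rightRes q ha =
        triple (e ×ₚ (p ×ₚ q)) ((e ×ₚ (p ×ₚ q)) ⋆ₚ p) q (h.rightRes ha).left.1
          (h.rightRes ha).left.2 := by
      apply PPath.ext
      · change e ×ₚ ((e ⋆ₚ p) ×ₚ q) = _
        rw [P3_left]; rfl
      · change [(e ⋆ₚ p) ×ₚ q, q] = [(e ×ₚ (p ×ₚ q)) ⋆ₚ p, q]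
        rw [rmul_lmul_eq]
    have hr : (triple e (p ×ₚ f) f h.right.1 h.right.2).rightRes q hb =
        triple (e ×ₚ (p ×ₚ q)) (p ×ₚ q) q (h.rightRes ha).right.1 (h.rightRes ha).right.2 := by
      apply PPath.ext
      · change e ×ₚ ((p ×ₚ f) ×ₚ q) = _
        rw [Le.lmul_lmul ha]; rfl
      · change [(p ×ₚ f) ×ₚ q, q] = [p ×ₚ q, q]
        rw [Le.lmul_lmul ha]
    rw [hl, hr]
    exact adm _ p q (h.rightRes ha)
  | @comp_left u a b ha hb h ih =>
    intro q hqa hqb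
    rw [rightRes_comp, rightRes_comp]
    have h1 := ih q (cod_comp u a ha ▸ hqa) (cod_comp u b hb ▸ hqb)
    exact (rightRes_congr rfl h1.dom_eq _ _).comp h1 _
  | comp_right v ha hb h ih =>
    intro q hqa hqb
    rw [rightRes_comp, rightRes_comp]
    exact comp_right _ _ _ (ih _ _ _)

end Rel
end
end PPath

/-- DRC semigroups. -/
class DRCSemigroup (S : Type*) extends Semigroup S where
  plus : S → S
  ast : S → S
  plus_mul_self (x : S) : plus x * x = x
  plus_mul (x y : S) : plus (x * y) = plus (x * plus y)
  plus_mul' (x y : S) : plus (x * y) = plus x * plus (x * y) * plus x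
  plus_plus (x : S) : plus (plus x) = plus x
  ast_plus (x : S) : ast (plus x) = plus x
  mul_ast_self (x : S) : x * ast x = x
  ast_mul (x y : S) : ast (x * y) = ast (ast x * y)
  ast_mul' (x y : S) : ast (x * y) = ast y * ast (x * y) * ast y
  ast_ast (x : S) : ast (ast x) = ast x
  plus_ast (x : S) : plus (ast x) = ast x

/-- DRC-restriction semigroups: DRC semigroups with the two DRC-ample conditions. -/
class DRCRestrictionSemigroup (S : Type*) extends DRCSemigroup S where
  ample_ast (x y : S) : x * ast (y * x) = ast (y * plus x) * x
  ample_plus (x y : S) : plus (x * y) * x = x * plus (ast x * y)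

open DRCSemigroup DRCRestrictionSemigroup

/-- The set `P(S) = {x⁺ | x ∈ S}` of projections. -/
def projections (S : Type*) [DRCSemigroup S] : Set S := Set.range plus

theorem plus_mem {S : Type*} [DRCSemigroup S] (x : S) : plus x ∈ projections S := ⟨x, rfl⟩

theorem ast_mem {S : Type*} [DRCSemigroup S] (x : S) : ast x ∈ projections S :=
  ⟨ast x, plus_ast x⟩

/-- The operations `e × f = (e f)⁺` and `e ⋆ f = (e f)*` on `P(S)`. -/
instance {S : Type*} [DRCSemigroup S] : ProjectionOps (projections S) where
  lmul e f := ⟨plus (e.1 * f.1), plus_mem _⟩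
  rmul e f := ⟨ast (e.1 * f.1), ast_mem _⟩

/-- Isomorphisms of projection algebras. -/
structure ProjectionIso (P Q : Type*) [ProjectionOps P] [ProjectionOps Q] extends P ≃ Q where
  map_lmul (e f : P) : toFun (e ×ₚ f) = toFun e ×ₚ toFun f
  map_rmul (e f : P) : toFun (e ⋆ₚ f) = toFun e ⋆ₚ toFun f

/-- `(2,1,1)`-isomorphisms. -/
structure DRCIso (S T : Type*) [DRCSemigroup S] [DRCSemigroup T] extends S ≃* T where
  map_plus (x : S) : toFun (plus x) = plus (toFun x)
  map_ast (x : S) : toFun (ast x) = ast (toFun x)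

/-- `𝐄(S)`, the subsemigroup generated by the projections of `S`. -/
def E (S : Type*) [DRCSemigroup S] : Subsemigroup S := Subsemigroup.closure (projections S)

theorem projections_subset_E {S : Type*} [DRCSemigroup S] : projections S ⊆ E S :=
  Subsemigroup.subset_closure

/-- `𝐄(S)` with the operations inherited from `S`. -/
instance {S : Type*} [DRCRestrictionSemigroup S] : DRCRestrictionSemigroup (E S) where
  plus x := ⟨plus x.1, projections_subset_E (plus_mem _)⟩
  ast x := ⟨ast x.1, projections_subset_E (ast_mem _)⟩
  plus_mul_self x := Subtype.ext (plus_mul_self x.1)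
  plus_mul x y := Subtype.ext (plus_mul x.1 y.1)
  plus_mul' x y := Subtype.ext (plus_mul' x.1 y.1)
  plus_plus x := Subtype.ext (plus_plus x.1)
  ast_plus x := Subtype.ext (ast_plus x.1)
  mul_ast_self x := Subtype.ext (mul_ast_self x.1)
  ast_mul x y := Subtype.ext (ast_mul x.1 y.1)
  ast_mul' x y := Subtype.ext (ast_mul' x.1 y.1)
  ast_ast x := Subtype.ext (ast_ast x.1)
  plus_ast x := Subtype.ext (plus_ast x.1)
  ample_ast x y := Subtype.ext (ample_ast x.1 y.1)
  ample_plus x y := Subtype.ext (ample_plus x.1 y.1)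

/-- `S` is projection-generated if `𝐄(S) = S`. -/
def IsProjectionGenerated (S : Type*) [DRCSemigroup S] : Prop := E S = ⊤

/-- `(2,1,1)`-congruences. -/
structure DRCCon (S : Type*) [DRCSemigroup S] extends Con S where
  plus' {a b : S} : r a b → r (plus a) (plus b)
  ast' {a b : S} : r a b → r (ast a) (ast b)

namespace DRCCon
variable {S : Type*}

/-- A `(2,1,1)`-congruence is projection-separating if distinct projections are not related. -/
def IsProjectionSeparating [DRCSemigroup S] (σ : DRCCon S) : Prop :=
  ∀ p ∈ projections S, ∀ q ∈ projections S, σ.r p q → p = q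

/-- The quotient of a DRC-restriction semigroup by a `(2,1,1)`-congruence. -/
def Quotient [DRCSemigroup S] (σ : DRCCon S) : Type _ := σ.toCon.Quotient

instance [DRCRestrictionSemigroup S] (σ : DRCCon S) : DRCRestrictionSemigroup σ.Quotient where
  __ := (inferInstance : Semigroup σ.toCon.Quotient)
  plus := Quotient.map' plus fun _ _ => σ.plus'
  ast := Quotient.map' ast fun _ _ => σ.ast'
  plus_mul_self := by rintro ⟨x⟩; exact congrArg σ.toCon.toQuotient (plus_mul_self x)
  plus_mul := by rintro ⟨x⟩ ⟨y⟩; exact congrArg σ.toCon.toQuotient (plus_mul x y)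
  plus_mul' := by rintro ⟨x⟩ ⟨y⟩; exact congrArg σ.toCon.toQuotient (plus_mul' x y)
  plus_plus := by rintro ⟨x⟩; exact congrArg σ.toCon.toQuotient (plus_plus x)
  ast_plus := by rintro ⟨x⟩; exact congrArg σ.toCon.toQuotient (ast_plus x)
  mul_ast_self := by rintro ⟨x⟩; exact congrArg σ.toCon.toQuotient (mul_ast_self x)
  ast_mul := by rintro ⟨x⟩ ⟨y⟩; exact congrArg σ.toCon.toQuotient (ast_mul x y)
  ast_mul' := by rintro ⟨x⟩ ⟨y⟩; exact congrArg σ.toCon.toQuotient (ast_mul' x y)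
  ast_ast := by rintro ⟨x⟩; exact congrArg σ.toCon.toQuotient (ast_ast x)
  plus_ast := by rintro ⟨x⟩; exact congrArg σ.toCon.toQuotient (plus_ast x)
  ample_ast := by rintro ⟨x⟩ ⟨y⟩; exact congrArg σ.toCon.toQuotient (ample_ast x y)
  ample_plus := by rintro ⟨x⟩ ⟨y⟩; exact congrArg σ.toCon.toQuotient (ample_plus x y)

end DRCCon

/-- `S` is projection-fundamental if the identity is its only projection-separating
`(2,1,1)`-congruence. -/
def IsProjectionFundamental (S : Type*) [DRCSemigroup S] : Prop :=
  ∀ σ : DRCCon S, σ.IsProjectionSeparating → ∀ a b, σ.r a b → a = b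

/-- The relation `μ_S`: `a⁺ = b⁺`, `a* = b*`, and `(a p)⁺ = (b p)⁺`, `(p a)* = (p b)*` for all
projections `p`. -/
def MuRel {S : Type*} [DRCSemigroup S] (a b : S) : Prop :=
  plus a = plus b ∧ ast a = ast b ∧
    ∀ p ∈ projections S, plus (a * p) = plus (b * p) ∧ ast (p * a) = ast (p * b)

section
variable {S : Type*} [DRCSemigroup S] {a b : S}

theorem MuRel.refl (a : S) : MuRel a a := ⟨rfl, rfl, fun _ _ => ⟨rfl, rfl⟩⟩

theorem MuRel.symm (h : MuRel a b) : MuRel b a :=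
  ⟨h.1.symm, h.2.1.symm, fun p hp => ⟨(h.2.2 p hp).1.symm, (h.2.2 p hp).2.symm⟩⟩

theorem MuRel.trans {c : S} (h : MuRel a b) (h' : MuRel b c) : MuRel a c :=
  ⟨h.1.trans h'.1, h.2.1.trans h'.2.1, fun p hp =>
    ⟨(h.2.2 p hp).1.trans (h'.2.2 p hp).1, (h.2.2 p hp).2.trans (h'.2.2 p hp).2⟩⟩

theorem MuRel.mul_left (h : MuRel a b) (c : S) : MuRel (c * a) (c * b) := by
  refine ⟨?_, ?_, fun p hp => ⟨?_, ?_⟩⟩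
  · rw [plus_mul c a, h.1, ← plus_mul]
  · rw [ast_mul c a, (h.2.2 _ (ast_mem c)).2, ← ast_mul]
  · rw [mul_assoc, plus_mul c, (h.2.2 p hp).1, ← plus_mul, mul_assoc]
  · rw [← mul_assoc, ast_mul _ a, (h.2.2 _ (ast_mem (p * c))).2, ← ast_mul, mul_assoc]

theorem MuRel.mul_right (h : MuRel a b) (c : S) : MuRel (a * c) (b * c) := by
  refine ⟨?_, ?_, fun p hp => ⟨?_, ?_⟩⟩
  · rw [plus_mul a c, (h.2.2 _ (plus_mem c)).1, ← plus_mul]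
  · rw [ast_mul a c, h.2.1, ← ast_mul]
  · rw [mul_assoc, plus_mul a, (h.2.2 _ (plus_mem (c * p))).1, ← plus_mul, mul_assoc]
  · rw [← mul_assoc, ast_mul _ c, (h.2.2 p hp).2, ← ast_mul, mul_assoc]
end

/-- The congruence `μ_S`, which is the maximum projection-separating `(2,1,1)`-congruence. -/
def muCon (S : Type*) [DRCSemigroup S] : DRCCon S where
  r := MuRel
  iseqv := ⟨MuRel.refl, MuRel.symm, MuRel.trans⟩
  mul' h h' := (h.mul_right _).trans (h'.mul_left _)
  plus' {a b} h := by
    rw [h.1]; exact MuRel.refl _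
  ast' {a b} h := by
    rw [h.2.1]; exact MuRel.refl _

namespace PPath
variable {P : Type*} [StrongProjectionAlgebra P]

theorem mul_dom (a b : PPath P) :
    (a.mul b).dom = (a.rightRes (a.cod ×ₚ b.dom) (lmul_le _ _)).dom := rfl

theorem mul_cod (a b : PPath P) :
    (a.mul b).cod = (b.leftRes (a.cod ⋆ₚ b.dom) (rmul_le _ _)).cod := cod_comp _ _ _

namespace Rel

theorem mul {a a' b b' : PPath P} (h : Rel a a') (h' : Rel b b') :
    Rel (a.mul b) (a'.mul b') := by
  have key : ∀ (c d : P) (hc : a'.cod = c) (hd : b'.dom = d) (h1 : Le (c ×ₚ d) a'.cod)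
      (h2 : Le (c ⋆ₚ d) b'.dom),
      a'.mul b' = ((a'.rightRes (c ×ₚ d) h1).comp
        (pair (c ×ₚ d) (c ⋆ₚ d) (f_lmul_rmul _ _)) (cod_rightRes _ _ _)).comp
        (b'.leftRes (c ⋆ₚ d) h2) (cod_comp _ _ _) := by
    rintro _ _ rfl rfl _ _; rfl
  rw [key a.cod b.dom h.cod_eq.symm h'.dom_eq.symm (h.cod_eq ▸ lmul_le _ _)
    (h'.dom_eq ▸ rmul_le _ _)]
  exact ((h.rightRes _ _ _).comp (refl _) _).comp (h'.leftRes _ _ _) _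

end Rel

theorem rel_of_eq {a b : PPath P} (h : a = b) : Rel a b := h ▸ Rel.refl a

theorem single_mul (a : PPath P) (t : P) (h : Le t a.dom) :
    Rel ((single t).mul a) (a.leftRes t h) := by
  have h1 : (single t).mul a = (pair t t (f_refl t)).comp (a.leftRes t h) rfl := by
    apply PPath.ext
    · change t ×ₚ a.dom = t
      exact h.lmul'
    · change (t ⋆ₚ a.dom) :: leftTail (t ⋆ₚ a.dom) a.tail = t :: leftTail t a.tail
      rw [h.rmul]
  have h2 : (single t).comp (a.leftRes t h) rfl = a.leftRes t h := PPath.ext rfl rfl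
  rw [h1]
  exact ((Rel.dup t).comp (Rel.refl _) _).trans (rel_of_eq h2)

theorem mul_single (a : PPath P) (t : P) (h : Le t a.cod) :
    Rel (a.mul (single t)) (a.rightRes t h) := by
  have h1 : a.mul (single t) =
      (a.rightRes t h).comp (pair t t (f_refl t)) (cod_rightRes _ _ _) := by
    apply PPath.ext
    · change (rightPair a.head a.tail (a.cod ×ₚ t)).1 = (rightPair a.head a.tail t).1
      rw [h.lmul]
    · change (rightPair a.head a.tail (a.cod ×ₚ t)).2 ++ [a.cod ⋆ₚ t] ++ [] =
        (rightPair a.head a.tail t).2 ++ [t]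
      rw [h.lmul, h.rmul', List.append_nil]
  have h2 : (a.rightRes t h).comp (single t) (cod_rightRes _ _ _) = a.rightRes t h :=
    PPath.ext rfl (List.append_nil _)
  rw [h1]
  exact ((Rel.refl _).comp (Rel.dup t) _).trans (rel_of_eq h2)

theorem cod_single_mul (a : PPath P) (t : P) (h : Le t a.dom) :
    ((single t).mul a).cod = (a.leftRes t h).cod := (single_mul a t h).cod_eq

theorem single_mul_single {t d : P} (h : Le t d) : Rel ((single t).mul (single d)) (single t) :=
  (single_mul (single d) t h).trans (rel_of_eq (PPath.ext rfl rfl))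

theorem single_mul_single' {t d : P} (h : Le t d) : Rel ((single d).mul (single t)) (single t) :=
  (mul_single (single d) t h).trans (rel_of_eq (PPath.ext rfl rfl))

/-- The middle parts of `(x • p) • y` and `x • (p • y)` come from an admissible triple. -/
theorem admissible_middle (r p s : P) :
    Admissible (r ×ₚ (p ×ₚ s)) p ((r ⋆ₚ p) ⋆ₚ s) := by
  constructor
  · rw [← rmul_lmul_eq, lmul_rmul_rmul]
  · rw [← rmul_lmul_eq', lmul_lmul_rmul]

theorem mul_assoc_single_left (x y : PPath P) (p : P) :
    ∃ (h1 : _) (h2 : _) (h3 : _), (x.mul (single p)).mul y =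
      ((x.rightRes (x.cod ×ₚ (p ×ₚ y.dom)) (lmul_le _ _)).comp
        (triple (x.cod ×ₚ (p ×ₚ y.dom)) ((x.cod ×ₚ (p ×ₚ y.dom)) ⋆ₚ p) ((x.cod ⋆ₚ p) ⋆ₚ y.dom)
          (admissible_middle _ _ _).left.1 (admissible_middle _ _ _).left.2) h1).comp
        (y.leftRes ((x.cod ⋆ₚ p) ⋆ₚ y.dom) h2) h3 := by
  refine ⟨cod_rightRes _ _ _, rmul_le _ _, cod_comp _ _ _, ?_⟩
  have hc : (x.mul (single p)).cod = x.cod ⋆ₚ p := by rw [mul_cod]; rfl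
  have ht : (x.mul (single p)).tail =
      (rightPair x.head x.tail (x.cod ×ₚ p)).2 ++ [x.cod ⋆ₚ p] := List.append_nil _
  have hl : last (rightPair x.head x.tail (x.cod ×ₚ p)).1
      (rightPair x.head x.tail (x.cod ×ₚ p)).2 = x.cod ×ₚ p := rightPair_last _ _ _
  have he : (x.cod ×ₚ p) ×ₚ ((x.cod ⋆ₚ p) ×ₚ y.dom) = x.cod ×ₚ (p ×ₚ y.dom) := by
    rw [← P3_left y.dom p x.cod]
    exact ((lmul_le _ _).trans (rmul_le _ _)).lmul_lmul _
  have hle : Le (x.cod ×ₚ (p ×ₚ y.dom)) (x.cod ×ₚ p) := (lmul_le p y.dom).lmul_mono _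
  have hp : rightPair (x.mul (single p)).head (x.mul (single p)).tail
      ((x.cod ⋆ₚ p) ×ₚ y.dom) =
      ((rightPair x.head x.tail (x.cod ×ₚ (p ×ₚ y.dom))).1,
        (rightPair x.head x.tail (x.cod ×ₚ (p ×ₚ y.dom))).2 ++ [(x.cod ⋆ₚ p) ×ₚ y.dom]) := by
    rw [ht]
    change rightPair (rightPair x.head x.tail (x.cod ×ₚ p)).1 _ _ = _
    rw [rightPair_append, hl]
    simp only [rightPair, he]
    rw [rightPair_rightPair _ _ _ _ hle]
  apply PPath.ext
  · change (rightPair (x.mul (single p)).head (x.mul (single p)).tail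
      ((x.mul (single p)).cod ×ₚ y.dom)).1 = _
    rw [hc, hp]; rfl
  · change (rightPair (x.mul (single p)).head (x.mul (single p)).tail
      ((x.mul (single p)).cod ×ₚ y.dom)).2 ++ [(x.mul (single p)).cod ⋆ₚ y.dom] ++
      leftTail ((x.mul (single p)).cod ⋆ₚ y.dom) y.tail =
      (rightPair x.head x.tail (x.cod ×ₚ (p ×ₚ y.dom))).2 ++
        [(x.cod ×ₚ (p ×ₚ y.dom)) ⋆ₚ p, (x.cod ⋆ₚ p) ⋆ₚ y.dom] ++
        leftTail ((x.cod ⋆ₚ p) ⋆ₚ y.dom) y.tail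
    rw [hc, hp, ← rmul_lmul_eq]
    simp

theorem mul_assoc_single_right (x y : PPath P) (p : P) :
    ∃ (h1 : _) (h2 : _) (h3 : _), x.mul ((single p).mul y) =
      ((x.rightRes (x.cod ×ₚ (p ×ₚ y.dom)) (lmul_le _ _)).comp
        (triple (x.cod ×ₚ (p ×ₚ y.dom)) (p ×ₚ ((x.cod ⋆ₚ p) ⋆ₚ y.dom)) ((x.cod ⋆ₚ p) ⋆ₚ y.dom)
          (admissible_middle _ _ _).right.1 (admissible_middle _ _ _).right.2) h1).comp
        (y.leftRes ((x.cod ⋆ₚ p) ⋆ₚ y.dom) h2) h3 := by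
  refine ⟨cod_rightRes _ _ _, rmul_le _ _, cod_comp _ _ _, ?_⟩
  have hf : (x.cod ⋆ₚ (p ×ₚ y.dom)) ⋆ₚ (p ⋆ₚ y.dom) = (x.cod ⋆ₚ p) ⋆ₚ y.dom := by
    rw [← P3_right x.cod p y.dom]
    exact ((rmul_le _ _).trans (lmul_le _ _)).rmul_rmul _
  have hle : Le ((x.cod ⋆ₚ p) ⋆ₚ y.dom) (p ⋆ₚ y.dom) := (rmul_le x.cod p).rmul_mono _
  apply PPath.ext
  · rfl
  · change (rightPair x.head x.tail (x.cod ×ₚ (p ×ₚ y.dom))).2 ++ [x.cod ⋆ₚ (p ×ₚ y.dom)] ++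
      (((x.cod ⋆ₚ (p ×ₚ y.dom)) ⋆ₚ (p ⋆ₚ y.dom)) ::
        leftTail ((x.cod ⋆ₚ (p ×ₚ y.dom)) ⋆ₚ (p ⋆ₚ y.dom)) (leftTail (p ⋆ₚ y.dom) y.tail)) =
      (rightPair x.head x.tail (x.cod ×ₚ (p ×ₚ y.dom))).2 ++
        [p ×ₚ ((x.cod ⋆ₚ p) ⋆ₚ y.dom), (x.cod ⋆ₚ p) ⋆ₚ y.dom] ++
        leftTail ((x.cod ⋆ₚ p) ⋆ₚ y.dom) y.tail
    rw [hf, leftTail_leftTail _ _ _ hle, rmul_lmul_eq']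
    simp

theorem mul_assoc_single (x y : PPath P) (p : P) :
    Rel ((x.mul (single p)).mul y) (x.mul ((single p).mul y)) := by
  obtain ⟨h1, h2, h3, h⟩ := mul_assoc_single_left x y p
  obtain ⟨h1', h2', h3', h'⟩ := mul_assoc_single_right x y p
  rw [h, h']
  exact ((Rel.refl _).comp (Rel.adm _ _ _ (admissible_middle _ _ _)) _).comp (Rel.refl _) _

theorem single_mul_tail (p x : P) (l : List P) (h : List.IsChain F (p :: x :: l)) :
    (single p).mul ⟨x, l, h.tail⟩ = ⟨p, x :: l, h⟩ := by
  have h1 := (List.isChain_cons_cons.1 h).1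
  apply PPath.ext
  · exact h1.1
  · change (p ⋆ₚ x) :: leftTail (p ⋆ₚ x) l = x :: l
    rw [h1.2, leftTail_self l x h.tail]

theorem mul_assoc_rel : ∀ (l : List P) (p : P) (h : List.IsChain F (p :: l)) (x y : PPath P),
    Rel ((x.mul ⟨p, l, h⟩).mul y) (x.mul (PPath.mul ⟨p, l, h⟩ y))
  | [], p, _, x, y => mul_assoc_single x y p
  | q :: l, p, h, x, y => by
    rw [← single_mul_tail p q l h]
    have ih := mul_assoc_rel l q h.tail
    have h1 := (mul_assoc_single x ⟨q, l, h.tail⟩ p).symm.mul (Rel.refl y)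
    have h2 := (Rel.refl x).mul (ih (single p) y)
    exact h1.trans ((ih (x.mul (single p)) y).trans ((mul_assoc_single x _ p).trans h2.symm))

/-- The relation `≈` as a setoid on paths. -/
def setoid (P : Type*) [StrongProjectionAlgebra P] : Setoid (PPath P) where
  r := Rel
  iseqv := ⟨Rel.refl, Rel.symm, Rel.trans⟩

end PPath

/-- The chain semigroup `𝐒(𝒞(P))`: its elements are the `≈`-classes `[p₁, …, pₖ]` of paths. -/
def ChainSemigroup (P : Type*) [StrongProjectionAlgebra P] : Type _ := _root_.Quotient (PPath.setoid P)

namespace ChainSemigroup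
variable {P : Type*} [StrongProjectionAlgebra P]

/-- The class `[a]` of a path `a`. -/
def mk (a : PPath P) : ChainSemigroup P := _root_.Quotient.mk (PPath.setoid P) a

theorem sound {a b : PPath P} (h : PPath.Rel a b) : mk a = mk b := _root_.Quotient.sound h

/-- Multiplication, and `[a]⁺ = [d(a)]`, `[a]* = [r(a)]`. -/
instance : DRCRestrictionSemigroup (ChainSemigroup P) where
  mul := _root_.Quotient.map₂ PPath.mul fun _ _ h _ _ h' => PPath.Rel.mul h h'
  plus := _root_.Quotient.lift (fun a => mk (.single a.dom)) fun _ _ h => by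
    rw [PPath.Rel.dom_eq h]
  ast := _root_.Quotient.lift (fun a => mk (.single a.cod)) fun _ _ h => by
    rw [PPath.Rel.cod_eq h]
  mul_assoc := by
    rintro ⟨x⟩ ⟨⟨p, l, h⟩⟩ ⟨y⟩
    exact sound (PPath.mul_assoc_rel l p h x y)
  plus_mul_self := by
    rintro ⟨x⟩
    exact sound ((PPath.single_mul x _ (le_refl _)).trans (PPath.rel_of_eq x.leftRes_dom))
  plus_mul := by rintro ⟨x⟩ ⟨y⟩; rfl
  plus_mul' := by
    rintro ⟨x⟩ ⟨y⟩
    have h : Le (x.mul y).dom x.dom := PPath.dom_rightRes_le _ _ (lmul_le _ _)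
    exact sound (((PPath.single_mul_single' h).mul (.refl _)).trans
      (PPath.single_mul_single h)).symm
  plus_plus := by rintro ⟨x⟩; rfl
  ast_plus := by rintro ⟨x⟩; rfl
  mul_ast_self := by
    rintro ⟨x⟩
    exact sound ((PPath.mul_single x _ (le_refl _)).trans (PPath.rel_of_eq x.rightRes_cod))
  ast_mul := by
    rintro ⟨x⟩ ⟨y⟩
    exact congrArg (fun p => mk (.single p)) ((x.mul_cod y).trans
      ((PPath.single x.cod).mul_cod y).symm)
  ast_mul' := by
    rintro ⟨x⟩ ⟨y⟩
    have h : Le (x.mul y).cod y.cod := by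
      rw [PPath.mul_cod]; exact PPath.cod_leftRes_le _ _ _
    exact sound (((PPath.single_mul_single' h).mul (.refl _)).trans
      (PPath.single_mul_single h)).symm
  ast_ast := by rintro ⟨x⟩; rfl
  plus_ast := by rintro ⟨x⟩; rfl
  ample_ast := by
    rintro ⟨x⟩ ⟨y⟩
    have h : Le (y.cod ⋆ₚ x.dom) x.dom := rmul_le _ _
    have hc := PPath.cod_leftRes_le x _ h
    have h1 : x.mul (.single (y.mul x).cod) = x.mul (.single (x.leftRes _ h).cod) := by
      rw [PPath.mul_cod]
    have h2 : (y.mul (.single x.dom)).cod = y.cod ⋆ₚ x.dom := PPath.mul_cod _ _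
    have h3 : (PPath.single (y.mul (.single x.dom)).cod).mul x =
        (PPath.single (y.cod ⋆ₚ x.dom)).mul x := by rw [h2]
    exact sound ((PPath.rel_of_eq h1).trans ((PPath.mul_single x _ hc).trans
      ((PPath.rel_of_eq (x.rightRes_leftRes _ h)).trans
      ((PPath.single_mul x _ h).symm.trans (PPath.rel_of_eq h3.symm)))))
  ample_plus := by
    rintro ⟨x⟩ ⟨y⟩
    have h : Le (x.cod ×ₚ y.dom) x.cod := lmul_le _ _
    have hd := PPath.dom_rightRes_le x _ h
    exact sound ((PPath.single_mul x _ hd).trans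
      ((PPath.rel_of_eq (x.leftRes_rightRes _ h)).trans (PPath.mul_single x _ h).symm))

end ChainSemigroup

/-! Triviality of `MuRel` characterises projection-fundamental semigroups, and whether two products
of projections are `MuRel`-related is decided inside the projection algebra. Take an identification
`f` of `P` with the projections of `S`, and let a word `w` over `P` stand for the product of its
letters in `S`. Since `(xy)⁺ = (xy⁺)⁺` and `(xy)* = (x*y)*`, the projections `w⁺`, `w*`, `(wp)⁺` and
`(pw)*` are obtained by iterating `×` and `⋆` along the letters, so they do not depend on `S`
(`exists_plus_lift_mul`, `exists_plus_lift` and their duals). Hence the relation that `MuRel`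
induces on words is the same for every semigroup with projection algebra `P` (`muRel_lift`).

If `S` is projection-generated and projection-fundamental, then every element is the value of a
word, and two words have the same value exactly when they are related in this sense. So `S` is the
free semigroup on `P` modulo a congruence determined by `P`, which gives uniqueness
(`nonempty_drcIso`).

It remains to see that both sides of the claimed isomorphisms are of this kind. Passing to `𝐄(S)`
keeps the projections and fundamentality. The chain semigroup is generated by its one-term paths,
which form a copy of `P`. Factoring out `μ` keeps that copy and makes the semigroup
projection-fundamental. -/

/-! ### Projection-fundamentality in terms of `μ` -/

section
variable {S : Type*} [DRCSemigroup S]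

theorem plus_of_mem_projections {p : S} (hp : p ∈ projections S) : plus p = p := by
  obtain ⟨x, rfl⟩ := hp
  exact plus_plus x

theorem ast_of_mem_projections {p : S} (hp : p ∈ projections S) : ast p = p := by
  obtain ⟨x, rfl⟩ := hp
  exact ast_plus x

theorem muCon_isProjectionSeparating : (muCon S).IsProjectionSeparating := by
  intro p hp q hq h
  have h1 : plus p = plus q := h.1
  rwa [plus_of_mem_projections hp, plus_of_mem_projections hq] at h1

/-- Every equation required by `MuRel` is between two projections obtained from `a` and `b` by
operations that `σ` respects. The two sides are therefore `σ`-related, and separation makes them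
equal. This is the maximality of `μ`. -/
theorem DRCCon.IsProjectionSeparating.muRel {σ : DRCCon S} (hσ : σ.IsProjectionSeparating)
    {a b : S} (h : σ.r a b) : MuRel a b :=
  ⟨hσ _ (plus_mem _) _ (plus_mem _) (σ.plus' h), hσ _ (ast_mem _) _ (ast_mem _) (σ.ast' h),
    fun p _ => ⟨hσ _ (plus_mem _) _ (plus_mem _) (σ.plus' (σ.mul' h (σ.iseqv.refl p))),
      hσ _ (ast_mem _) _ (ast_mem _) (σ.ast' (σ.mul' (σ.iseqv.refl p) h))⟩⟩

/-- Replaces the quantification over congruences by a test on pairs of elements: `μ` is itself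
projection-separating and contains all the others. -/
theorem isProjectionFundamental_iff :
    IsProjectionFundamental S ↔ ∀ a b : S, MuRel a b → a = b :=
  ⟨fun h => h (muCon S) muCon_isProjectionSeparating, fun h _ hσ a b hab => h a b (hσ.muRel hab)⟩

end

/-! ### Embeddings of `P` as a projection algebra, and words in projections -/

/-- The maps from `P` to `S` that identify `P` with the projection algebra of `S`. -/
structure IsProjectionMap {P S : Type*} [ProjectionOps P] [DRCSemigroup S] (f : P → S) :
    Prop where
  injective : Function.Injective f
  range_eq : Set.range f = projections S
  map_lmul (p q : P) : f (p ×ₚ q) = plus (f p * f q)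
  map_rmul (p q : P) : f (p ⋆ₚ q) = ast (f p * f q)

namespace IsProjectionMap
variable {P : Type*} [ProjectionOps P]

section
variable {S : Type*} [DRCSemigroup S] {f : P → S}

theorem mem (hf : IsProjectionMap f) (p : P) : f p ∈ projections S :=
  hf.range_eq ▸ Set.mem_range_self p

theorem plus_apply (hf : IsProjectionMap f) (p : P) : plus (f p) = f p :=
  plus_of_mem_projections (hf.mem p)

theorem ast_apply (hf : IsProjectionMap f) (p : P) : ast (f p) = f p :=
  ast_of_mem_projections (hf.mem p)

theorem of_projectionIso (e : ProjectionIso (projections S) P) :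
    IsProjectionMap fun p => (e.toEquiv.symm p : S) where
  injective := Subtype.val_injective.comp e.toEquiv.symm.injective
  range_eq := by
    rw [← Function.comp_def, Set.range_comp, e.toEquiv.symm.range_eq_univ, Set.image_univ,
      Subtype.range_coe]
  map_lmul p q := by
    have h : e.toEquiv.symm (p ×ₚ q) = e.toEquiv.symm p ×ₚ e.toEquiv.symm q := by
      rw [Equiv.symm_apply_eq]
      refine Eq.trans ?_ (e.map_lmul _ _).symm
      exact congrArg₂ _ (e.toEquiv.apply_symm_apply p).symm (e.toEquiv.apply_symm_apply q).symm
    exact congrArg Subtype.val h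
  map_rmul p q := by
    have h : e.toEquiv.symm (p ⋆ₚ q) = e.toEquiv.symm p ⋆ₚ e.toEquiv.symm q := by
      rw [Equiv.symm_apply_eq]
      refine Eq.trans ?_ (e.map_rmul _ _).symm
      exact congrArg₂ _ (e.toEquiv.apply_symm_apply p).symm (e.toEquiv.apply_symm_apply q).symm
    exact congrArg Subtype.val h

theorem nonempty_projectionIso (hf : IsProjectionMap f) :
    Nonempty (ProjectionIso (projections S) P) := by
  let e : P ≃ projections S := Equiv.ofBijective (fun p => ⟨f p, hf.mem p⟩)
    ⟨fun p q h => hf.injective (congrArg Subtype.val h), by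
      rintro ⟨x, hx⟩
      rw [← hf.range_eq] at hx
      obtain ⟨p, rfl⟩ := hx
      exact ⟨p, rfl⟩⟩
  have hl (p q : P) : e (p ×ₚ q) = e p ×ₚ e q := Subtype.ext (hf.map_lmul p q)
  have hr (p q : P) : e (p ⋆ₚ q) = e p ⋆ₚ e q := Subtype.ext (hf.map_rmul p q)
  refine ⟨⟨e.symm, fun x y => ?_, fun x y => ?_⟩⟩
  · refine e.symm_apply_eq.2 ((hl _ _).trans ?_).symm
    exact congrArg₂ _ (e.apply_symm_apply x) (e.apply_symm_apply y)
  · refine e.symm_apply_eq.2 ((hr _ _).trans ?_).symm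
    exact congrArg₂ _ (e.apply_symm_apply x) (e.apply_symm_apply y)

/-- Lets elements of `S` be handled as words over `P`, on which two different semigroups can be
compared. -/
theorem lift_surjective (hf : IsProjectionMap f) (hS : IsProjectionGenerated S) :
    Function.Surjective (FreeSemigroup.lift f) := by
  intro x
  have hx : x ∈ E S := by
    rw [show E S = ⊤ from hS]
    trivial
  refine Subsemigroup.closure_induction (p := fun x _ => ∃ w, FreeSemigroup.lift f w = x)
    ?_ ?_ hx
  · intro y hy
    rw [← hf.range_eq] at hy
    obtain ⟨p, rfl⟩ := hy
    exact ⟨FreeSemigroup.of p, FreeSemigroup.lift_of f p⟩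
  · rintro _ _ _ _ ⟨u, rfl⟩ ⟨v, rfl⟩
    exact ⟨u * v, map_mul _ u v⟩

end

/-! ### Comparison of two semigroups with the same projection algebra -/

section
variable {S T : Type*} [DRCSemigroup S] [DRCSemigroup T] {f : P → S} {g : P → T}

/-- A letter `x` sends `p` to `x × p`, and `(xyp)⁺ = (x(yp)⁺)⁺` shows that a word acts by composing
its letters, the last one first. The point is that one `q` serves both `f` and `g`, because it is
computed in `P`. -/
theorem exists_plus_lift_mul (hf : IsProjectionMap f) (hg : IsProjectionMap g)
    (w : FreeSemigroup P) : ∀ p : P, ∃ q : P,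
      plus (FreeSemigroup.lift f w * f p) = f q ∧ plus (FreeSemigroup.lift g w * g p) = g q := by
  induction w using FreeSemigroup.recOnMul with
  | ih1 x =>
    intro p
    exact ⟨x ×ₚ p, by rw [FreeSemigroup.lift_of, hf.map_lmul],
      by rw [FreeSemigroup.lift_of, hg.map_lmul]⟩
  | ih2 x y ihx ihy =>
    intro p
    obtain ⟨q, hq, hq'⟩ := ihy p
    obtain ⟨r, hr, hr'⟩ := ihx q
    exact ⟨r, by rw [map_mul, mul_assoc, plus_mul, hq, hr],
      by rw [map_mul, mul_assoc, plus_mul, hq', hr']⟩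

theorem exists_ast_mul_lift (hf : IsProjectionMap f) (hg : IsProjectionMap g)
    (w : FreeSemigroup P) : ∀ p : P, ∃ q : P,
      ast (f p * FreeSemigroup.lift f w) = f q ∧ ast (g p * FreeSemigroup.lift g w) = g q := by
  induction w using FreeSemigroup.recOnMul with
  | ih1 x =>
    intro p
    exact ⟨p ⋆ₚ x, by rw [FreeSemigroup.lift_of, hf.map_rmul],
      by rw [FreeSemigroup.lift_of, hg.map_rmul]⟩
  | ih2 x y ihx ihy =>
    intro p
    obtain ⟨q, hq, hq'⟩ := ihx p
    obtain ⟨r, hr, hr'⟩ := ihy q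
    exact ⟨r, by rw [map_mul, ← mul_assoc, ast_mul, hq, hr],
      by rw [map_mul, ← mul_assoc, ast_mul, hq', hr']⟩

/-- The last letter is already a projection and starts the iteration; the preceding letters then act
on it through `(xy)⁺ = (xy⁺)⁺`. -/
theorem exists_plus_lift (hf : IsProjectionMap f) (hg : IsProjectionMap g)
    (w : FreeSemigroup P) : ∃ q : P,
      plus (FreeSemigroup.lift f w) = f q ∧ plus (FreeSemigroup.lift g w) = g q := by
  induction w using FreeSemigroup.recOnMul with
  | ih1 x =>
    exact ⟨x, by rw [FreeSemigroup.lift_of, hf.plus_apply],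
      by rw [FreeSemigroup.lift_of, hg.plus_apply]⟩
  | ih2 x y _ ihy =>
    obtain ⟨q, hq, hq'⟩ := ihy
    obtain ⟨r, hr, hr'⟩ := exists_plus_lift_mul hf hg (FreeSemigroup.of x) q
    exact ⟨r, by rw [map_mul, plus_mul, hq, hr], by rw [map_mul, plus_mul, hq', hr']⟩

theorem exists_ast_lift (hf : IsProjectionMap f) (hg : IsProjectionMap g)
    (w : FreeSemigroup P) : ∃ q : P,
      ast (FreeSemigroup.lift f w) = f q ∧ ast (FreeSemigroup.lift g w) = g q := by
  induction w using FreeSemigroup.recOnMul with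
  | ih1 x =>
    exact ⟨x, by rw [FreeSemigroup.lift_of, hf.ast_apply],
      by rw [FreeSemigroup.lift_of, hg.ast_apply]⟩
  | ih2 x y ihx _ =>
    obtain ⟨q, hq, hq'⟩ := ihx
    obtain ⟨r, hr, hr'⟩ := exists_ast_mul_lift hf hg y q
    exact ⟨r, by rw [map_mul, ast_mul, hq, hr], by rw [map_mul, ast_mul, hq', hr']⟩

/-- Whether two words in projections are `μ`-related depends on the projection algebra only. -/
theorem muRel_lift (hf : IsProjectionMap f) (hg : IsProjectionMap g) {u v : FreeSemigroup P}
    (h : MuRel (FreeSemigroup.lift f u) (FreeSemigroup.lift f v)) :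
    MuRel (FreeSemigroup.lift g u) (FreeSemigroup.lift g v) := by
  -- Equality of projections passes from `S` to `T` through `P`: injectivity of `f` identifies the
  -- two labels, and then `g` gives equal values.
  have key {a b : S} {c d : T} (h1 : ∃ q, a = f q ∧ c = g q) (h2 : ∃ q, b = f q ∧ d = g q)
      (hab : a = b) : c = d := by
    obtain ⟨q, rfl, rfl⟩ := h1
    obtain ⟨r, rfl, rfl⟩ := h2
    rw [hf.injective hab]
  refine ⟨key (exists_plus_lift hf hg u) (exists_plus_lift hf hg v) h.1,
    key (exists_ast_lift hf hg u) (exists_ast_lift hf hg v) h.2.1, fun x hx => ?_⟩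
  rw [← hg.range_eq] at hx
  obtain ⟨p, rfl⟩ := hx
  have hp := h.2.2 _ (hf.mem p)
  exact ⟨key (exists_plus_lift_mul hf hg u p) (exists_plus_lift_mul hf hg v p) hp.1,
    key (exists_ast_mul_lift hf hg u p) (exists_ast_mul_lift hf hg v p) hp.2⟩

/-- Words with equal values in `S` are trivially `MuRel`-related there, hence also in `T`, where
this relation is equality. Only the target has to be projection-fundamental, so the two directions
of the isomorphism use one hypothesis each. -/
theorem lift_eq_lift (hf : IsProjectionMap f) (hg : IsProjectionMap g)
    (hT : IsProjectionFundamental T) {u v : FreeSemigroup P}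
    (h : FreeSemigroup.lift f u = FreeSemigroup.lift f v) :
    FreeSemigroup.lift g u = FreeSemigroup.lift g v :=
  isProjectionFundamental_iff.1 hT _ _ (muRel_lift hf hg (h ▸ MuRel.refl _))

/-- Projection-generated projection-fundamental semigroups with the same projection algebra are
isomorphic. -/
theorem nonempty_drcIso (hf : IsProjectionMap f) (hg : IsProjectionMap g)
    (hS : IsProjectionGenerated S) (hT : IsProjectionGenerated T)
    (hS' : IsProjectionFundamental S) (hT' : IsProjectionFundamental T) :
    Nonempty (DRCIso S T) := by
  -- `c` chooses a word for each element of `S`; `hφ` below shows that the value in `T` does not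
  -- depend on this choice.
  obtain ⟨c, hc⟩ := (hf.lift_surjective hS).hasRightInverse
  let φ : S → T := fun s => FreeSemigroup.lift g (c s)
  have hφ (w : FreeSemigroup P) : φ (FreeSemigroup.lift f w) = FreeSemigroup.lift g w :=
    lift_eq_lift hf hg hT' (hc _)
  have hφp (p : P) : φ (f p) = g p := by
    have := hφ (FreeSemigroup.of p)
    rwa [FreeSemigroup.lift_of, FreeSemigroup.lift_of] at this
  have hmul (s t : S) : φ (s * t) = φ s * φ t := by
    have := hφ (c s * c t)
    rwa [map_mul, map_mul, hc, hc] at this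
  have hbij : Function.Bijective φ := by
    refine ⟨fun s t h => ?_, fun t => ?_⟩
    -- The same comparison with the roles of `S` and `T` exchanged.
    · have := lift_eq_lift hg hf hS' h
      rwa [hc, hc] at this
    · obtain ⟨w, rfl⟩ := hg.lift_surjective hT t
      exact ⟨_, hφ w⟩
  refine ⟨⟨MulEquiv.ofBijective (⟨φ, hmul⟩ : S →ₙ* T) hbij, fun s => ?_, fun s => ?_⟩⟩
  · obtain ⟨q, hq, hq'⟩ := exists_plus_lift hf hg (c s)
    rw [hc] at hq
    change φ (plus s) = plus (φ s)
    rw [hq, hφp]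
    exact hq'.symm
  · obtain ⟨q, hq, hq'⟩ := exists_ast_lift hf hg (c s)
    rw [hc] at hq
    change φ (ast s) = ast (φ s)
    rw [hq, hφp]
    exact hq'.symm

end

end IsProjectionMap

/-! ### Inheritance by `𝐄(S)` and by quotients -/

section
variable {S : Type*} [DRCRestrictionSemigroup S]

theorem mem_projections_E_iff {x : E S} : x ∈ projections (E S) ↔ (x : S) ∈ projections S := by
  constructor
  · rintro ⟨y, rfl⟩
    exact plus_mem _
  · intro hx
    exact ⟨x, Subtype.ext (plus_of_mem_projections hx)⟩

theorem isProjectionGenerated_E : IsProjectionGenerated (E S) := by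
  have h : projections (E S) = ((↑) : E S → S) ⁻¹' projections S :=
    Set.ext fun x => mem_projections_E_iff
  change Subsemigroup.closure (projections (E S)) = ⊤
  rw [h]
  exact Subsemigroup.closure_closure_coe_preimage

/-- `𝐄(S)` contains all projections of `S`, so `MuRel` on `𝐄(S)` runs through the same test
projections and implies `MuRel` in `S`. -/
theorem IsProjectionFundamental.E (hS : IsProjectionFundamental S) :
    IsProjectionFundamental (E S) := by
  rw [isProjectionFundamental_iff] at hS ⊢
  intro a b h
  refine Subtype.ext (hS _ _ ⟨congrArg Subtype.val h.1, congrArg Subtype.val h.2.1,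
    fun p hp => ?_⟩)
  have := h.2.2 ⟨p, projections_subset_E hp⟩ (mem_projections_E_iff.2 hp)
  exact ⟨congrArg Subtype.val this.1, congrArg Subtype.val this.2⟩

theorem IsProjectionMap.codRestrict {P : Type*} [ProjectionOps P] {f : P → S}
    (hf : IsProjectionMap f) :
    IsProjectionMap fun p => (⟨f p, projections_subset_E (hf.mem p)⟩ : E S) where
  injective p q h := hf.injective (congrArg Subtype.val h)
  range_eq := by
    ext x
    rw [mem_projections_E_iff, ← hf.range_eq]
    exact exists_congr fun p => Subtype.ext_iff
  map_lmul p q := Subtype.ext (hf.map_lmul p q)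
  map_rmul p q := Subtype.ext (hf.map_rmul p q)

theorem projections_quotient (σ : DRCCon S) :
    projections σ.Quotient = σ.toCon.toQuotient '' projections S := by
  ext x
  constructor
  · rintro ⟨⟨y⟩, rfl⟩
    exact ⟨_, plus_mem y, rfl⟩
  · rintro ⟨_, ⟨y, rfl⟩, rfl⟩
    exact ⟨σ.toCon.toQuotient y, rfl⟩

theorem IsProjectionGenerated.quotient (hS : IsProjectionGenerated S) (σ : DRCCon S) :
    IsProjectionGenerated σ.Quotient := by
  refine (Subsemigroup.eq_top_iff' _).2 ?_
  rintro ⟨x⟩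
  have hx : x ∈ E S := by
    rw [show E S = ⊤ from hS]
    trivial
  refine Subsemigroup.closure_induction
    (p := fun x _ => (σ.toCon.toQuotient x : σ.Quotient) ∈ _root_.E σ.Quotient) ?_ ?_ hx
  · intro y hy
    refine projections_subset_E ?_
    rw [projections_quotient]
    exact Set.mem_image_of_mem _ hy
  · intro y z _ _ hy hz
    exact mul_mem hy hz

/-- The equations witnessing `MuRel` between two classes are equations between classes of
projections of `S`. Since `μ` separates projections, each of them already holds in `S`, so the
representatives are `μ`-related and the classes coincide. -/
theorem isProjectionFundamental_quotient_muCon :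
    IsProjectionFundamental (muCon S).Quotient := by
  rw [isProjectionFundamental_iff]
  have key {x y : S} (hx : x ∈ projections S) (hy : y ∈ projections S)
      (h : (muCon S).toCon.toQuotient x = (muCon S).toCon.toQuotient y) : x = y :=
    muCon_isProjectionSeparating x hx y hy ((Con.eq _).1 h)
  rintro ⟨a⟩ ⟨b⟩ h
  refine (Con.eq (muCon S).toCon).2 ⟨key (plus_mem _) (plus_mem _) h.1,
    key (ast_mem _) (ast_mem _) h.2.1, fun p hp => ?_⟩
  have := h.2.2 ((muCon S).toCon.toQuotient p)
    (by rw [projections_quotient]; exact Set.mem_image_of_mem _ hp)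
  exact ⟨key (plus_mem _) (plus_mem _) this.1, key (ast_mem _) (ast_mem _) this.2⟩

theorem IsProjectionMap.quotient {P : Type*} [ProjectionOps P] {f : P → S}
    (hf : IsProjectionMap f) {σ : DRCCon S} (hσ : σ.IsProjectionSeparating) :
    IsProjectionMap (S := σ.Quotient) fun p => σ.toCon.toQuotient (f p) where
  injective p q h := hf.injective (hσ _ (hf.mem p) _ (hf.mem q) ((Con.eq _).1 h))
  range_eq := by
    rw [projections_quotient, ← hf.range_eq, ← Set.range_comp]
    rfl
  map_lmul p q := congrArg σ.toCon.toQuotient (hf.map_lmul p q)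
  map_rmul p q := congrArg σ.toCon.toQuotient (hf.map_rmul p q)

end

/-! ### The chain semigroup: projections and generation -/

namespace ChainSemigroup
variable {P : Type*} [StrongProjectionAlgebra P]

/-- Injectivity holds because `≈` preserves the first entry of a path. The operations match by
computation: `(p)` times `(q)` is the path `(p × q, p ⋆ q)`, whose endpoints are the two required
projections. -/
theorem isProjectionMap_single : IsProjectionMap fun p : P => mk (.single p) where
  injective _ _ h := (_root_.Quotient.exact h : PPath.Rel _ _).dom_eq
  range_eq := by
    ext x
    constructor
    · rintro ⟨p, rfl⟩
      exact ⟨mk (.single p), rfl⟩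
    · rintro ⟨⟨a⟩, rfl⟩
      exact ⟨a.dom, rfl⟩
  map_lmul _ _ := rfl
  map_rmul _ _ := rfl

/-- A path `(p₁, …, pₖ)` is the product of its entries: when `p 𝓕 x`, multiplying a path that starts
at `x` by `(p)` on the left restricts nothing and merely prepends `p`. -/
theorem isProjectionGenerated : IsProjectionGenerated (ChainSemigroup P) := by
  refine (Subsemigroup.eq_top_iff' _).2 ?_
  have key : ∀ (l : List P) (p : P) (h : List.IsChain F (p :: l)),
      mk ⟨p, l, h⟩ ∈ E (ChainSemigroup P) := by
    intro l
    induction l with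
    | nil => exact fun p _ => projections_subset_E (isProjectionMap_single.mem p)
    | cons x l ih =>
      intro p h
      rw [← PPath.single_mul_tail p x l h]
      exact mul_mem (projections_subset_E (isProjectionMap_single.mem p)) (ih x h.tail)
  rintro ⟨⟨p, l, h⟩⟩
  exact key l p h

end ChainSemigroup

/-! ### The main theorem -/

theorem theorem8p10 {P : Type*} [StrongProjectionAlgebra P] :
    (IsProjectionGenerated (muCon (ChainSemigroup P)).Quotient ∧
      IsProjectionFundamental (muCon (ChainSemigroup P)).Quotient ∧
      Nonempty (ProjectionIso (projections (muCon (ChainSemigroup P)).Quotient) P)) ∧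
    ∀ (S : Type*) [DRCRestrictionSemigroup S],
      IsProjectionFundamental S → Nonempty (ProjectionIso (projections S) P) →
        Nonempty (DRCIso (E S) (muCon (ChainSemigroup P)).Quotient) ∧
        (IsProjectionGenerated S → Nonempty (DRCIso S (muCon (ChainSemigroup P)).Quotient)) := by
  have hgen := (ChainSemigroup.isProjectionGenerated (P := P)).quotient (muCon _)
  have hfun := isProjectionFundamental_quotient_muCon (S := ChainSemigroup P)
  have hmap := (ChainSemigroup.isProjectionMap_single (P := P)).quotient
    muCon_isProjectionSeparating
  refine ⟨⟨hgen, hfun, hmap.nonempty_projectionIso⟩, ?_⟩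
  rintro S _ hS ⟨e⟩
  have hf := IsProjectionMap.of_projectionIso e
  exact ⟨hf.codRestrict.nonempty_drcIso hmap isProjectionGenerated_E hgen hS.E hfun,
    fun hg => hf.nonempty_drcIso hmap hg hgen hS hfun⟩
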